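/- Let $\mathcal C$ be a pointed model category with functorial factorizations and zero object $*$. Write $\mathrm{Ho}(\mathcal C)$ for its homotopy category (the localization at the weak equivalences) and $[W,F]$ for the set of morphisms from $W$ to $F$ in $\mathrm{Ho}(\mathcal C)$. A cofibration $i\colon A\to B$ has a *fibrant obstruction theory* if there are an object $W$ of $\mathcal C$ and an assignment which, to every fibration $p\colon X\to Y$ with $Y$ fibrant and every commutative square from $i$ to $p$ (a pair $f\colon A\to X$, $g\colon B\to Y$ with $pf=gi$), associates a class $\alpha\in[W,F]$, where $F$ is the fibre (kernel) of $p$, such that 1. the square has a lift (a map $l\colon B\to X$ with $li=f$ and $pl=g$) if and only if $\alpha$ is the trivial class; 2. for every commutative square from $p$ to another fibration $p'$ with fibrant target and fibre $F'$, the class assigned to the composite square from $i$ to $p'$ is the composite of $\alpha$ with the class of the induced map $F\to F'$. Let $\Sigma\colon\mathrm{Ho}(\mathcal C)\to\mathrm{Ho}(\mathcal C)$ be the left derived suspension functor, obtained by applying to a functorial cofibrant replacement the functor $A\mapsto CA/A$, where $A\to CA$ is a functorial cofibration with $CA$ weakly contractible; and let $\Omega\colon\mathrm{Ho}(\mathcal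 C)\to\mathrm{Ho}(\mathcal C)$ be the right derived loop functor, obtained by applying to a functorial fibrant replacement the functor sending $X$ to the fibre of $PX\to X$, where $PX\to X$ is a functorial fibration with $PX$ weakly contractible. **Corollary 7.4.** Let $B$ be a cofibrant object of $\mathcal C$. If the cofibration $*\to B$ has a fibrant obstruction theory, then $B$ is weakly equivalent to a retract of $\Sigma\Omega B$: there are objects $R$ and $S$ of $\mathcal C$ such that $B$ and $R$ are connected by a finite zigzag of weak equivalences, $R$ is a retract of $S$ in $\mathcal C$, and $S$ is isomorphic to $\Sigma\Omega B$ in $\mathrm{Ho}(\mathcal C)$. -/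

import Mathlib

open CategoryTheory Limits HomotopicalAlgebra
open scoped ZeroObject

universe v u

namespace ObstructionTheory

section WeakEquivalencesAndFibres

variable {C : Type u} [Category.{v} C] [ModelCategory C]

/-- A trivial fibration between objects over a fixed base induces a weak equivalence on fibres. -/
lemma fibre_aux {Y X X' F F' O : C} {p : X ⟶ Y} {p' : X' ⟶ Y} {b : O ⟶ Y}
    {k : F ⟶ X} {z : F ⟶ O} {k' : F' ⟶ X'} {z' : F' ⟶ O}
    (h : IsPullback k z p b) (h' : IsPullback k' z' p' b)
    (f : X ⟶ X') (hf : f ≫ p' = p) [Fibration f] [WeakEquivalence f]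
    (φ : F ⟶ F') (hφ : φ ≫ k' = k ≫ f) (hz : φ ≫ z' = z) : WeakEquivalence φ := by
  have sq : IsPullback k φ f k' := by
    refine (IsPullback.of_right (h₁₁ := φ) (v₁₁ := k) (v₁₂ := k') (h₂₁ := f)
      (h₁₂ := z') (h₂₂ := p') (v₁₃ := b) ?_ hφ h'.flip).flip
    rw [hf, hz]
    exact h.flip
  have := MorphismProperty.of_isPullback (P := trivialFibrations C) sq (mem_trivialFibrations f)
  rw [mem_trivialFibrations_iff] at this
  exact this.2

/-- A weak equivalence between fibrations with the same target induces a weak equivalence on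
fibres. -/
lemma fibre_weakEquivalence_over {Y X X' F F' O : C} {p : X ⟶ Y} {p' : X' ⟶ Y} {b : O ⟶ Y}
    [Fibration p] [Fibration p']
    {k : F ⟶ X} {z : F ⟶ O} {k' : F' ⟶ X'} {z' : F' ⟶ O}
    (h : IsPullback k z p b) (h' : IsPullback k' z' p' b)
    (f : X ⟶ X') (hf : f ≫ p' = p) [WeakEquivalence f]
    (φ : F ⟶ F') (hφ : φ ≫ k' = k ≫ f) (hz : φ ≫ z' = z) : WeakEquivalence φ := by
  have fib (T : Over Y) (hT : Fibration T.hom) : IsFibrant T := by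
    rw [isFibrant_iff_of_isTerminal (Over.mkIdTerminal.from T) Over.mkIdTerminal,
      fibrations_over_iff]
    have : (Over.mkIdTerminal.from T).left = T.hom := by
      simp
    rwa [this]
  have := fib (Over.mk p) ‹_›
  have := fib (Over.mk p') ‹_›
  let g : Over.mk p ⟶ Over.mk p' := Over.homMk f hf
  have : WeakEquivalence g := by rw [weakEquivalences_over_iff]; exact ‹WeakEquivalence f›
  obtain ⟨d⟩ : Nonempty (FibrantBrownFactorization g) := inferInstance
  let hZ := IsPullback.of_hasPullback d.Z.hom b
  have wi : d.i.left ≫ d.Z.hom = p := Over.w d.i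
  have wp : d.p.left ≫ p' = d.Z.hom := Over.w d.p
  have wr : d.r.left ≫ p = d.Z.hom := Over.w d.r
  have fac : d.i.left ≫ d.p.left = f := by
    rw [← Over.comp_left, d.fac]; rfl
  have ir : d.i.left ≫ d.r.left = 𝟙 X := by
    rw [← Over.comp_left, d.i_r]; rfl
  let α : F ⟶ pullback d.Z.hom b := hZ.lift (k ≫ d.i.left) z (by
    rw [Category.assoc, wi, h.w])
  let β : pullback d.Z.hom b ⟶ F' := h'.lift (pullback.fst _ _ ≫ d.p.left) (pullback.snd _ _) (by
    rw [Category.assoc, wp, hZ.w])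
  let ρ : pullback d.Z.hom b ⟶ F := h.lift (pullback.fst _ _ ≫ d.r.left) (pullback.snd _ _) (by
    rw [Category.assoc, wr, hZ.w])
  have : WeakEquivalence d.p.left := by
    have : WeakEquivalence d.p := inferInstance
    infer_instance
  have : WeakEquivalence d.r.left := by
    have : WeakEquivalence d.r := inferInstance
    infer_instance
  have : WeakEquivalence β :=
    fibre_aux hZ h' d.p.left wp β (h'.lift_fst _ _ _) (h'.lift_snd _ _ _)
  have : WeakEquivalence ρ :=
    fibre_aux hZ h d.r.left wr ρ (h.lift_fst _ _ _) (h.lift_snd _ _ _)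
  have e1 : α ≫ ρ = 𝟙 F := by
    apply h.hom_ext
    · rw [Category.assoc, h.lift_fst, ← Category.assoc, hZ.lift_fst, Category.assoc, ir]; simp
    · rw [Category.assoc, h.lift_snd, hZ.lift_snd]; simp
  have e2 : α ≫ β = φ := by
    apply h'.hom_ext
    · rw [Category.assoc, h'.lift_fst, ← Category.assoc, hZ.lift_fst, Category.assoc, fac, hφ]
    · rw [Category.assoc, h'.lift_snd, hZ.lift_snd, hz]
  have : WeakEquivalence α := weakEquivalence_of_postcomp_of_fac e1
  rw [← e2]
  infer_instance

/-- A map of fibrations consisting of a weak equivalence of total spaces and a trivial fibration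
of bases induces a weak equivalence on fibres over zero objects. -/
lemma fibre_weakEquivalence {X Y X' Y' F F' O O' : C} (hO : IsZero O) (hO' : IsZero O')
    {p : X ⟶ Y} {p' : X' ⟶ Y'} [Fibration p] [Fibration p']
    {b : O ⟶ Y} {b' : O' ⟶ Y'}
    {k : F ⟶ X} {z : F ⟶ O} {k' : F' ⟶ X'} {z' : F' ⟶ O'}
    (h : IsPullback k z p b) (h' : IsPullback k' z' p' b')
    (f : X ⟶ X') (g : Y ⟶ Y') (sq : f ≫ p' = p ≫ g) [WeakEquivalence f]
    [Fibration g] [WeakEquivalence g]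
    (φ : F ⟶ F') (hφ : φ ≫ k' = k ≫ f) : WeakEquivalence φ := by
  let P := pullback p' g
  have hP : IsPullback (pullback.fst p' g) (pullback.snd p' g) p' g :=
    IsPullback.of_hasPullback p' g
  let c : X ⟶ P := pullback.lift f p sq
  have hc1 : c ≫ pullback.fst p' g = f := pullback.lift_fst _ _ _
  have hc2 : c ≫ pullback.snd p' g = p := pullback.lift_snd _ _ _
  have : WeakEquivalence c := weakEquivalence_of_postcomp_of_fac hc1
  have hb : hO.to_ O' ≫ b' = b ≫ g := hO.eq_of_src _ _
  have hb' : hO'.to_ O ≫ b ≫ g = b' := hO'.eq_of_src _ _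
  let l : F' ⟶ P := pullback.lift k' (z' ≫ hO'.to_ O ≫ b) (by
    rw [h'.w, Category.assoc, Category.assoc, hb'])
  have hl1 : l ≫ pullback.fst p' g = k' := pullback.lift_fst _ _ _
  have hl2 : l ≫ pullback.snd p' g = (z' ≫ hO'.to_ O) ≫ b := by
    rw [Category.assoc]; exact pullback.lift_snd _ _ _
  have big : IsPullback (l ≫ pullback.fst p' g) (z' ≫ hO'.to_ O) p' (b ≫ g) := by
    rw [hl1]
    refine IsPullback.of_iso h' (Iso.refl _) (Iso.refl _) (hO'.iso hO) (Iso.refl _)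
      (by simp) ?_ (by simp) (hO'.eq_of_src _ _)
    simp [IsZero.iso]
  have small : IsPullback l (z' ≫ hO'.to_ O) (pullback.snd p' g) b :=
    (IsPullback.of_right (h₁₁ := l) (h₁₂ := pullback.fst p' g) big hl2 hP)
  refine fibre_weakEquivalence_over h small c hc2 φ ?_ (hO.eq_of_tgt _ _)
  apply pullback.hom_ext
  · rw [Category.assoc, hl1, Category.assoc, hc1, hφ]
  · rw [Category.assoc k, hc2, h.w, Category.assoc, hl2, ← Category.assoc φ]
    congr 1
    exact hO.eq_of_tgt _ _

/-- The dual statement about cofibres. -/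
lemma cofibre_weakEquivalence {A B A' B' K K' O O' : C} (hO : IsZero O) (hO' : IsZero O')
    {i : A ⟶ B} {i' : A' ⟶ B'} [Cofibration i] [Cofibration i']
    {a : A ⟶ O} {a' : A' ⟶ O'}
    {q : B ⟶ K} {z : O ⟶ K} {q' : B' ⟶ K'} {z' : O' ⟶ K'}
    (h : IsPushout i a q z) (h' : IsPushout i' a' q' z')
    (f : A ⟶ A') (g : B ⟶ B') (sq : f ≫ i' = i ≫ g) [WeakEquivalence g]
    [Cofibration f] [WeakEquivalence f]
    (φ : K ⟶ K') (hφ : q ≫ φ = g ≫ q') : WeakEquivalence φ := by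
  rw [← weakEquivalences_op_iff]
  refine fibre_weakEquivalence (C := Cᵒᵖ) hO'.op hO.op h'.op.flip h.op.flip g.op f.op ?_ φ.op ?_
  · rw [← op_comp, ← op_comp, sq]
  · rw [← op_comp, ← op_comp, hφ]

end WeakEquivalencesAndFibres

section WeaklyEquivalent

variable {C : Type u} [Category.{v} C] [ModelCategory C]

/-- Two objects are weakly equivalent if they are connected by a finite zigzag of weak
equivalences. -/
def WeaklyEquivalent (X Y : C) : Prop :=
  Relation.EqvGen (fun X' Y' : C => ∃ f : X' ⟶ Y', WeakEquivalence f) X Y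

end WeaklyEquivalent

section HomotopyCategory

variable (C : Type u) [Category.{v} C] [ModelCategory C]

/-- The homotopy category: the localization of `C` at its weak equivalences. -/
abbrev Ho : Type u := (weakEquivalences C).Localization

/-- The localization functor from `C` to its homotopy category. -/
abbrev toHo : C ⥤ Ho C := (weakEquivalences C).Q

end HomotopyCategory

section FibrantObstructionTheory

variable {C : Type u} [Category.{v} C] [ModelCategory C] [HasZeroMorphisms C] [HasZeroObject C]

/-- A fibrant obstruction theory for a cofibration `i : A ⟶ B` in a pointed model category:
an object `W`, and for every fibration `p` with fibrant target and every commutative square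
from `i` to `p`, a weak homotopy class from `W` to the fibre of `p` that is trivial if and
only if the square has a lift, functorially in `p`. -/
structure FibrantObstructionTheory {A B : C} (i : A ⟶ B) where
  /-- the object from which the obstruction classes are mapped -/
  W : C
  /-- the obstruction of a square, an element of `[W, F]` with `F` the fibre of `p` -/
  obstruction {X Y : C} (p : X ⟶ Y) [Fibration p] [IsFibrant Y]
    (sq : Arrow.mk i ⟶ Arrow.mk p) : (toHo C).obj W ⟶ (toHo C).obj (kernel p)
  exists_lift_iff {X Y : C} (p : X ⟶ Y) [Fibration p] [IsFibrant Y]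
    (sq : Arrow.mk i ⟶ Arrow.mk p) :
    (∃ l : B ⟶ X, i ≫ l = sq.left ∧ l ≫ p = sq.right) ↔
      obstruction p sq = (toHo C).map 0
  obstruction_comp {X Y X' Y' : C} (p : X ⟶ Y) [Fibration p] [IsFibrant Y]
    (p' : X' ⟶ Y') [Fibration p'] [IsFibrant Y']
    (sq : Arrow.mk i ⟶ Arrow.mk p) (φ : Arrow.mk p ⟶ Arrow.mk p') :
    obstruction p' (sq ≫ φ) =
      obstruction p sq ≫ (toHo C).map (kernel.map p p' φ.left φ.right φ.w.symm)

/-- The map `i` has a fibrant obstruction theory. -/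
def HasFibrantObstructionTheory {A B : C} (i : A ⟶ B) : Prop :=
  Nonempty (FibrantObstructionTheory i)

end FibrantObstructionTheory

section Replacements

variable (C : Type u) [Category.{v} C] [ModelCategory C] [HasZeroMorphisms C] [HasZeroObject C]
  [MorphismProperty.HasFunctorialFactorization (cofibrations C) (trivialFibrations C)]
  [MorphismProperty.HasFunctorialFactorization (trivialCofibrations C) (fibrations C)]

/-- The chosen functorial factorization into a cofibration followed by a trivial fibration. -/
noncomputable abbrev cofTrivFib :
    MorphismProperty.FunctorialFactorizationData (cofibrations C) (trivialFibrations C) :=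
  MorphismProperty.functorialFactorizationData _ _

/-- The chosen functorial factorization into a trivial cofibration followed by a fibration. -/
noncomputable abbrev trivCofFib :
    MorphismProperty.FunctorialFactorizationData (trivialCofibrations C) (fibrations C) :=
  MorphismProperty.functorialFactorizationData _ _

/-- The functor sending `X` to the arrow `* ⟶ X`. -/
@[simps]
noncomputable def fromZero : C ⥤ Arrow C where
  obj X := Arrow.mk (0 : (0 : C) ⟶ X)
  map f := Arrow.homMk (𝟙 _) f

/-- The functor sending `X` to the arrow `X ⟶ *`. -/
@[simps]
noncomputable def toZero : C ⥤ Arrow C where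
  obj X := Arrow.mk (0 : X ⟶ (0 : C))
  map f := Arrow.homMk f (𝟙 _)

/-- Functorial cofibrant replacement. -/
noncomputable def cofibrantReplacement : C ⥤ C := fromZero C ⋙ (cofTrivFib C).Z

/-- Functorial fibrant replacement. -/
noncomputable def fibrantReplacement : C ⥤ C := toZero C ⋙ (trivCofFib C).Z

/-- The natural trivial fibration from the cofibrant replacement. -/
noncomputable def fromCofibrantReplacement : cofibrantReplacement C ⟶ 𝟭 C where
  app X := (cofTrivFib C).p.app ((fromZero C).obj X)
  naturality _ _ f := (cofTrivFib C).p.naturality ((fromZero C).map f)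

/-- The natural trivial cofibration to the fibrant replacement. -/
noncomputable def toFibrantReplacement : 𝟭 C ⟶ fibrantReplacement C where
  app X := (trivCofFib C).i.app ((toZero C).obj X)
  naturality _ _ f := (trivCofFib C).i.naturality ((toZero C).map f)

/-- The functorial cone: `X ⟶ *` factors as a cofibration `X ⟶ cone X` followed by a trivial
fibration. -/
noncomputable def cone : C ⥤ C := toZero C ⋙ (cofTrivFib C).Z

/-- The inclusion of an object into its cone. -/
noncomputable def coneInclusion : 𝟭 C ⟶ cone C where
  app X := (cofTrivFib C).i.app ((toZero C).obj X)
  naturality _ _ f := (cofTrivFib C).i.naturality ((toZero C).map f)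

/-- The functorial path object: `* ⟶ X` factors as a trivial cofibration followed by a fibration
`path X ⟶ X`. -/
noncomputable def path : C ⥤ C := fromZero C ⋙ (trivCofFib C).Z

/-- The projection from the path object. -/
noncomputable def pathProjection : path C ⟶ 𝟭 C where
  app X := (trivCofFib C).p.app ((fromZero C).obj X)
  naturality _ _ f := (trivCofFib C).p.naturality ((fromZero C).map f)

/-- The point-set suspension functor: the cofibre of the cone inclusion. -/
noncomputable def pointSetSuspension : C ⥤ C where
  obj X := cokernel ((coneInclusion C).app X)
  map f := cokernel.map _ _ f ((cone C).map f) ((coneInclusion C).naturality f).symm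

/-- The point-set loop functor: the fibre of the path projection. -/
noncomputable def pointSetLoops : C ⥤ C where
  obj X := kernel ((pathProjection C).app X)
  map f := kernel.map _ _ ((path C).map f) f ((pathProjection C).naturality f).symm

variable {C}

instance (X : C) : Cofibration ((coneInclusion C).app X) := by
  rw [cofibration_iff]; exact (cofTrivFib C).hi _

instance (X : C) : Fibration ((pathProjection C).app X) := by
  rw [fibration_iff]; exact (trivCofFib C).hp _

/-- The cone on any object is weakly contractible. -/
lemma weakEquivalence_cone (X : C) : WeakEquivalence (0 : (cone C).obj X ⟶ 0) := by
  have h := (mem_trivialFibrations_iff _).1 ((cofTrivFib C).hp ((toZero C).obj X))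
  have e : (cofTrivFib C).p.app ((toZero C).obj X) = (0 : (cone C).obj X ⟶ 0) :=
    (isZero_zero C).eq_of_tgt _ _
  rw [← e]; exact h.2

/-- The path object of any object is weakly contractible. -/
lemma weakEquivalence_path (X : C) : WeakEquivalence (0 : (0 : C) ⟶ (path C).obj X) := by
  have h := (mem_trivialCofibrations_iff _).1 ((trivCofFib C).hi ((fromZero C).obj X))
  have e : (trivCofFib C).i.app ((fromZero C).obj X) = (0 : (0 : C) ⟶ (path C).obj X) :=
    (isZero_zero C).eq_of_src _ _
  rw [← e]; exact h.2

instance {X Y : C} (f : X ⟶ Y) : WeakEquivalence ((cone C).map f) :=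
  have := weakEquivalence_cone X
  have := weakEquivalence_cone Y
  weakEquivalence_of_postcomp_of_fac (g := (0 : (cone C).obj Y ⟶ 0)) comp_zero

instance {X Y : C} (f : X ⟶ Y) : WeakEquivalence ((path C).map f) :=
  have := weakEquivalence_path X
  have := weakEquivalence_path Y
  weakEquivalence_of_precomp_of_fac (f := (0 : (0 : C) ⟶ (path C).obj X)) zero_comp

instance (X : C) : IsCofibrant ((cofibrantReplacement C).obj X) :=
  (isCofibrant_iff_of_isInitial ((cofTrivFib C).i.app ((fromZero C).obj X))
    (isZero_zero C).isInitial).2 ((cofibration_iff _).2 ((cofTrivFib C).hi _))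

instance (X : C) : IsFibrant ((fibrantReplacement C).obj X) :=
  (isFibrant_iff_of_isTerminal ((trivCofFib C).p.app ((toZero C).obj X))
    (isZero_zero C).isTerminal).2 ((fibration_iff _).2 ((trivCofFib C).hp _))

instance (X : C) : WeakEquivalence ((fromCofibrantReplacement C).app X) :=
  ((mem_trivialFibrations_iff _).1 ((cofTrivFib C).hp ((fromZero C).obj X))).2

instance (X : C) : WeakEquivalence ((toFibrantReplacement C).app X) :=
  ((mem_trivialCofibrations_iff _).1 ((trivCofFib C).hi ((toZero C).obj X))).2

instance {X Y : C} (f : X ⟶ Y) [hf : WeakEquivalence f] :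
    WeakEquivalence ((cofibrantReplacement C).map f) := by
  have : WeakEquivalence ((𝟭 C).map f) := hf
  exact weakEquivalence_of_postcomp_of_fac ((fromCofibrantReplacement C).naturality f)

instance {X Y : C} (f : X ⟶ Y) [hf : WeakEquivalence f] :
    WeakEquivalence ((fibrantReplacement C).map f) := by
  have : WeakEquivalence ((𝟭 C).map f) := hf
  exact weakEquivalence_of_precomp_of_fac ((toFibrantReplacement C).naturality f).symm

/-- Suspension sends trivial cofibrations to weak equivalences. -/
lemma pointSetSuspension_aux {X Y : C} (f : X ⟶ Y) [Cofibration f] [WeakEquivalence f] :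
    WeakEquivalence ((pointSetSuspension C).map f) := by
  have po (Z : C) : IsPushout ((coneInclusion C).app Z) (0 : Z ⟶ 0)
      (cokernel.π ((coneInclusion C).app Z)) 0 := by
    refine ⟨⟨by simp⟩, ⟨PushoutCocone.IsColimit.mk _ (fun s => cokernel.desc _ s.inl ?_) ?_ ?_ ?_⟩⟩
    · rw [s.condition, zero_comp]
    · intro s; simp
    · intro s; exact (isZero_zero C).eq_of_src _ _
    · intro s m hm _; ext; simpa using hm
  exact cofibre_weakEquivalence (isZero_zero C) (isZero_zero C) (po X) (po Y) f ((cone C).map f)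
    ((coneInclusion C).naturality f) _ (cokernel.π_desc _ _ _)

/-- Loops send trivial fibrations to weak equivalences. -/
lemma pointSetLoops_aux {X Y : C} (f : X ⟶ Y) [Fibration f] [WeakEquivalence f] :
    WeakEquivalence ((pointSetLoops C).map f) := by
  have pb (Z : C) : IsPullback (kernel.ι ((pathProjection C).app Z)) 0
      ((pathProjection C).app Z) (0 : (0 : C) ⟶ Z) := by
    refine ⟨⟨by simp⟩, ⟨PullbackCone.IsLimit.mk _ (fun s => kernel.lift _ s.fst ?_) ?_ ?_ ?_⟩⟩
    · rw [s.condition, comp_zero]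
    · intro s; simp
    · intro s; exact (isZero_zero C).eq_of_tgt _ _
    · intro s m hm _; ext; simpa using hm
  exact fibre_weakEquivalence (isZero_zero C) (isZero_zero C) (pb X) (pb Y) ((path C).map f) f
    ((pathProjection C).naturality f) _ (kernel.lift_ι _ _ _)

/-- Suspension preserves weak equivalences between cofibrant objects. -/
lemma weakEquivalence_pointSetSuspension {X Y : C} [IsCofibrant X] [IsCofibrant Y] (f : X ⟶ Y)
    [WeakEquivalence f] : WeakEquivalence ((pointSetSuspension C).map f) := by
  obtain ⟨d⟩ : Nonempty (CofibrantBrownFactorization f) := inferInstance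
  have : WeakEquivalence ((pointSetSuspension C).map d.i) := pointSetSuspension_aux _
  have : WeakEquivalence ((pointSetSuspension C).map d.s) := pointSetSuspension_aux _
  have : WeakEquivalence ((pointSetSuspension C).map d.p) :=
    weakEquivalence_of_precomp_of_fac (f := (pointSetSuspension C).map d.s)
      (fg := 𝟙 _) (by rw [← Functor.map_comp, d.s_p, CategoryTheory.Functor.map_id])
  rw [← d.fac, Functor.map_comp]
  infer_instance

/-- Loops preserve weak equivalences between fibrant objects. -/
lemma weakEquivalence_pointSetLoops {X Y : C} [IsFibrant X] [IsFibrant Y] (f : X ⟶ Y)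
    [WeakEquivalence f] : WeakEquivalence ((pointSetLoops C).map f) := by
  obtain ⟨d⟩ : Nonempty (FibrantBrownFactorization f) := inferInstance
  have : WeakEquivalence ((pointSetLoops C).map d.p) := pointSetLoops_aux _
  have : WeakEquivalence ((pointSetLoops C).map d.r) := pointSetLoops_aux _
  have : WeakEquivalence ((pointSetLoops C).map d.i) :=
    weakEquivalence_of_postcomp_of_fac (g := (pointSetLoops C).map d.r)
      (fg := 𝟙 _) (by rw [← Functor.map_comp, d.i_r, CategoryTheory.Functor.map_id])
  rw [← d.fac, Functor.map_comp]
  infer_instance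

variable (C)

/-- The left derived suspension functor on the homotopy category: the functor induced by applying
the point-set suspension to a functorial cofibrant replacement. -/
noncomputable def suspension : Ho C ⥤ Ho C :=
  Localization.Construction.lift (cofibrantReplacement C ⋙ pointSetSuspension C ⋙ toHo C)
    (fun _ _ f hf => by
      have : WeakEquivalence f := ⟨hf⟩
      exact (weakEquivalences C).Q_inverts _
        (weakEquivalence_pointSetSuspension ((cofibrantReplacement C).map f)).mem)

/-- The right derived loop functor on the homotopy category: the functor induced by applying the
point-set loop functor to a functorial fibrant replacement. -/
noncomputable def loops : Ho C ⥤ Ho C :=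
  Localization.Construction.lift (fibrantReplacement C ⋙ pointSetLoops C ⋙ toHo C)
    (fun _ _ f hf => by
      have : WeakEquivalence f := ⟨hf⟩
      exact (weakEquivalences C).Q_inverts _
        (weakEquivalence_pointSetLoops ((fibrantReplacement C).map f)).mem)

end Replacements

end ObstructionTheory

/-! Replace `B` by a fibrant `Y` along a trivial cofibration `j`, and consider lifting `j` through
the path fibration `PY ⟶ Y`. The obstruction lies in `[W, ΩY]`. Model the evaluation `ΣΩY ⟶ Y` by a
fibration `p : X ⟶ Y` and map `PY` to `X` over `Y`. The induced map from `ΩY` to the fibre of `p` is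
trivial in the homotopy category (`exists_fibration_suspension_loops`): a loop, transported into
`ΣΩY`, bounds a cone. By functoriality the obstruction to lifting `j` through `p` vanishes, so `j`
lifts; since `j` is a trivial cofibration, the lift extends to a section of `p`. Thus `Y` is a
retract of `X`, a model of `ΣΩB`.

The null-homotopy comes from `toHo_map_eq_zero_of_contractible`: two maps over `Y` from a
contractible cofibrant cone are homotopic over `Y`, and the homotopy restricts to fibres. -/

namespace ObstructionTheory

/-! ### Trivial classes in the homotopy category. -/

section ZeroMaps

variable {C : Type u} [Category.{v} C] [ModelCategory C] [HasZeroMorphisms C] [HasZeroObject C]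

/-- The image of a zero object is terminal in the homotopy category. -/
lemma comp_toHo_map_to_zero {V A : C} (f : (toHo C).obj V ⟶ (toHo C).obj A) :
    f ≫ (toHo C).map (0 : A ⟶ (0 : C)) = (toHo C).map 0 := by
  -- `f` need not come from `C`, so the maps to `0` are extended to a natural transformation on `Ho
  -- C`, whose naturality at `f` is the claim.
  let τ : toHo C ⋙ 𝟭 (Ho C) ⟶ toHo C ⋙ (Functor.const (Ho C)).obj ((toHo C).obj 0) :=
    { app X := (toHo C).map (0 : X ⟶ (0 : C))
      naturality X Y g := by
        simp only [Functor.comp_map, Functor.id_map, Functor.const_obj_map]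
        rw [← Functor.map_comp, comp_zero]
        exact (Category.comp_id _).symm }
  have := (Localization.Construction.natTransExtension τ).naturality f
  simp only [Functor.id_map, Functor.const_obj_map,
    Localization.Construction.natTransExtension_app,
    Localization.Construction.NatTransExtension.app_eq] at this
  exact this.trans (Category.comp_id _)

/-- The trivial class is stable under precomposition in the homotopy category. -/
lemma comp_toHo_map_zero {V A F : C} (f : (toHo C).obj V ⟶ (toHo C).obj A) :
    f ≫ (toHo C).map (0 : A ⟶ F) = (toHo C).map 0 := by
  have h (D : C) : (toHo C).map (0 : D ⟶ F) =
      (toHo C).map (0 : D ⟶ (0 : C)) ≫ (toHo C).map (0 : (0 : C) ⟶ F) := by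
    rw [← Functor.map_comp, comp_zero]
  rw [h, ← Category.assoc, comp_toHo_map_to_zero, ← h]

end ZeroMaps

/-! ### Homotopies over the base and their restriction to fibres. -/

section LiftsToFibrations

variable {C : Type u} [Category.{v} C] [ModelCategory C] [HasZeroMorphisms C] [HasZeroObject C]

lemma isPullback_kernel {X Y : C} (p : X ⟶ Y) :
    IsPullback (kernel.ι p) (0 : kernel p ⟶ 0) p (0 : (0 : C) ⟶ Y) := by
  refine ⟨⟨by simp⟩, ⟨PullbackCone.IsLimit.mk _ (fun s => kernel.lift _ s.fst ?_) ?_ ?_ ?_⟩⟩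
  · rw [s.condition, comp_zero]
  · intro s; simp
  · intro s; exact (isZero_zero C).eq_of_tgt _ _
  · intro s m hm _; ext; simpa using hm

/-- Let `u` and `w` be maps over `Y` from a cofibrant weakly contractible object `T` to a fibration
over `Y`. If a map to `T` is killed by `u`, then the map induced by `w` on fibres is trivial. -/
lemma toHo_map_eq_zero_of_contractible {X Y Q T : C} (p : X ⟶ Y) [Fibration p]
    [IsCofibrant T] [WeakEquivalence (0 : (0 : C) ⟶ T)] (i : Q ⟶ T) (u w : T ⟶ X)
    (huw : u ≫ p = w ≫ p) (hu : i ≫ u = 0) (φ : Q ⟶ kernel p) (hφ : φ ≫ kernel.ι p = i ≫ w) :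
    (toHo C).map φ = (toHo C).map 0 := by
  have : Cofibration (0 : (0 : C) ⟶ T) :=
    (isCofibrant_iff_of_isInitial _ (isZero_zero C).isInitial).1 inferInstance
  -- Factoring the relative diagonal makes `P.Z` a path object for `X` over `Y`, with endpoint maps
  -- `d₀` and `d₁`.
  let δ : X ⟶ pullback p p := pullback.lift (𝟙 X) (𝟙 X) rfl
  let P := MorphismProperty.factorizationData (trivialCofibrations C) (fibrations C) δ
  obtain ⟨_, _⟩ := (mem_trivialCofibrations_iff _).1 P.hi
  have : Fibration P.p := (fibration_iff _).2 P.hp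
  let d₀ : P.Z ⟶ X := P.p ≫ pullback.fst p p
  let d₁ : P.Z ⟶ X := P.p ≫ pullback.snd p p
  have hi₀ : P.i ≫ d₀ = 𝟙 X := by
    rw [← Category.assoc, P.fac]; exact pullback.lift_fst _ _ _
  have hi₁ : P.i ≫ d₁ = 𝟙 X := by
    rw [← Category.assoc, P.fac]; exact pullback.lift_snd _ _ _
  let q : P.Z ⟶ Y := d₀ ≫ p
  have hd₁ : d₁ ≫ p = q := by simp [q, d₀, d₁, pullback.condition]
  have : Fibration q := by dsimp only [q, d₀]; infer_instance
  have hiq : P.i ≫ q = p := by rw [← Category.assoc, hi₀, Category.id_comp]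
  let s : kernel p ⟶ kernel q := kernel.lift _ (kernel.ι p ≫ P.i) (by simp [hiq])
  have hs : s ≫ kernel.ι q = kernel.ι p ≫ P.i := kernel.lift_ι _ _ _
  have : WeakEquivalence s :=
    fibre_weakEquivalence_over (isPullback_kernel p) (isPullback_kernel q) P.i hiq s hs
      ((isZero_zero C).eq_of_tgt _ _)
  let r₀ : kernel q ⟶ kernel p := kernel.lift _ (kernel.ι q ≫ d₀) (by
    rw [Category.assoc]; exact kernel.condition q)
  let r₁ : kernel q ⟶ kernel p := kernel.lift _ (kernel.ι q ≫ d₁) (by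
    rw [Category.assoc, hd₁]; exact kernel.condition q)
  have hr₀ : r₀ ≫ kernel.ι p = kernel.ι q ≫ d₀ := kernel.lift_ι _ _ _
  have hr₁ : r₁ ≫ kernel.ι p = kernel.ι q ≫ d₁ := kernel.lift_ι _ _ _
  have hsr : s ≫ r₀ = s ≫ r₁ := by
    rw [← cancel_mono (kernel.ι p), Category.assoc, Category.assoc, hr₀, hr₁,
      ← Category.assoc s, ← Category.assoc s, hs, Category.assoc, Category.assoc, hi₀, hi₁]
  -- The endpoint maps on fibres share the section `s`, which becomes invertible.
  have hr : (toHo C).map r₀ = (toHo C).map r₁ := by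
    have : IsIso ((toHo C).map s) := (weakEquivalences C).Q_inverts _ (mem_weakEquivalences s)
    rw [← cancel_epi ((toHo C).map s), ← Functor.map_comp, ← Functor.map_comp, hsr]
  -- As `0 ⟶ T` is a trivial cofibration, the lift is a homotopy over `Y` from `u` to `w`.
  have sq : CommSq 0 (0 : (0 : C) ⟶ T) P.p (pullback.lift u w huw) :=
    ⟨(isZero_zero C).eq_of_src _ _⟩
  have hH₀ : sq.lift ≫ d₀ = u := by
    rw [← Category.assoc, sq.fac_right]; exact pullback.lift_fst _ _ _
  have hH₁ : sq.lift ≫ d₁ = w := by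
    rw [← Category.assoc, sq.fac_right]; exact pullback.lift_snd _ _ _
  -- On `Q` the homotopy starts at `0`, so it stays in the fibre over the base point: a
  -- null-homotopy of `φ`.
  let H : Q ⟶ kernel q := kernel.lift _ (i ≫ sq.lift) (by
    simp only [q, ← Category.assoc]
    rw [Category.assoc i, hH₀, hu, zero_comp])
  have hH : H ≫ kernel.ι q = i ≫ sq.lift := kernel.lift_ι _ _ _
  have e₀ : H ≫ r₀ = 0 := by
    rw [← cancel_mono (kernel.ι p), Category.assoc, hr₀, ← Category.assoc, hH, Category.assoc, hH₀,
      hu, zero_comp]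
  have e₁ : H ≫ r₁ = φ := by
    rw [← cancel_mono (kernel.ι p), Category.assoc, hr₁, ← Category.assoc, hH, Category.assoc, hH₁,
      hφ]
  rw [← e₀, ← e₁, Functor.map_comp, Functor.map_comp, hr]

end LiftsToFibrations

/-! ### The evaluation map `ΣΩY ⟶ Y` as a fibration. -/

section SuspensionOfLoops

variable {C : Type u} [Category.{v} C] [ModelCategory C] [HasZeroMorphisms C] [HasZeroObject C]
  [MorphismProperty.HasFunctorialFactorization (cofibrations C) (trivialFibrations C)]
  [MorphismProperty.HasFunctorialFactorization (trivialCofibrations C) (fibrations C)]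

/-- A fibration modelling the evaluation map `ΣΩY ⟶ Y` for `Y` fibrant; the connecting map from
`ΩY` to its fibre is trivial in the homotopy category. -/
lemma exists_fibration_suspension_loops (Y : C) [IsFibrant Y] :
    ∃ (X : C) (p : X ⟶ Y) (_ : Fibration p)
      (t : (pointSetSuspension C).obj
        ((cofibrantReplacement C).obj ((pointSetLoops C).obj Y)) ⟶ X)
      (_ : WeakEquivalence t)
      (h : (path C).obj Y ⟶ X) (w : (pathProjection C).app Y ≫ 𝟙 Y = h ≫ p),
      (toHo C).map (kernel.map ((pathProjection C).app Y) p h (𝟙 Y) w) = (toHo C).map 0 := by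
  let π : (path C).obj Y ⟶ Y := (pathProjection C).app Y
  have : Fibration π := inferInstanceAs (Fibration ((pathProjection C).app Y))
  let L := kernel π
  let Q := (cofibrantReplacement C).obj L
  let ε : Q ⟶ L := (fromCofibrantReplacement C).app L
  let ι : Q ⟶ (cone C).obj Q := (coneInclusion C).app Q
  have : Cofibration ι := inferInstanceAs (Cofibration ((coneInclusion C).app Q))
  have : WeakEquivalence ε := inferInstanceAs (WeakEquivalence ((fromCofibrantReplacement C).app L))
  have : IsCofibrant Q := inferInstanceAs (IsCofibrant ((cofibrantReplacement C).obj L))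
  have : IsCofibrant ((cone C).obj Q) := isCofibrant_of_cofibration ι
  have : WeakEquivalence (0 : (0 : C) ⟶ (cone C).obj Q) :=
    have := weakEquivalence_cone Q
    weakEquivalence_of_postcomp_of_fac (g := (0 : (cone C).obj Q ⟶ 0))
      (fg := 𝟙 0) ((isZero_zero C).eq_of_tgt _ _)
  have : Fibration (0 : (path C).obj Y ⟶ 0) :=
    (isFibrant_iff_of_isTerminal _ (isZero_zero C).isTerminal).1 (isFibrant_of_fibration π)
  have : WeakEquivalence (0 : (path C).obj Y ⟶ 0) :=
    have := weakEquivalence_path Y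
    weakEquivalence_of_precomp_of_fac (f := (0 : (0 : C) ⟶ (path C).obj Y))
      (fg := 𝟙 0) ((isZero_zero C).eq_of_tgt _ _)
  have : Cofibration (0 : (0 : C) ⟶ (path C).obj Y) := by
    have e : (trivCofFib C).i.app ((fromZero C).obj Y) = (0 : (0 : C) ⟶ (path C).obj Y) :=
      (isZero_zero C).eq_of_src _ _
    rw [← e]
    exact ((mem_trivialCofibrations_iff _).1 ((trivCofFib C).hi ((fromZero C).obj Y))).1
  have : WeakEquivalence (0 : (0 : C) ⟶ (path C).obj Y) := weakEquivalence_path Y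
  -- `PY` is fibrant because `Y` is, so `Q ⟶ PY` extends over the cone; projecting to `Y` kills `Q`
  -- and gives the evaluation `e`.
  have sqc : CommSq (ε ≫ kernel.ι π) ι (0 : (path C).obj Y ⟶ 0) 0 :=
    ⟨(isZero_zero C).eq_of_tgt _ _⟩
  let e : cokernel ι ⟶ Y := cokernel.desc ι (sqc.lift ≫ π) (by
    rw [← Category.assoc, sqc.fac_left, Category.assoc, kernel.condition, comp_zero])
  have he : cokernel.π ι ≫ e = sqc.lift ≫ π := cokernel.π_desc _ _ _
  let X := MorphismProperty.factorizationData (trivialCofibrations C) (fibrations C) e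
  obtain ⟨_, _⟩ := (mem_trivialCofibrations_iff _).1 X.hi
  have : Fibration X.p := (fibration_iff _).2 X.hp
  have sqh : CommSq 0 (0 : (0 : C) ⟶ (path C).obj Y) X.p π :=
    ⟨(isZero_zero C).eq_of_src _ _⟩
  have w : π ≫ 𝟙 Y = sqh.lift ≫ X.p := by rw [sqh.fac_right, Category.comp_id]
  refine ⟨X.Z, X.p, ‹_›, X.i, ‹_›, sqh.lift, w, ?_⟩
  -- Two maps from the cone to `X.Z` over `Y` are compared: one through the suspension, killing `Q`,
  -- and one through `PY`, restricting on `Q` to the connecting map.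
  have key : (toHo C).map (ε ≫ kernel.map π X.p sqh.lift (𝟙 Y) w) = (toHo C).map 0 := by
    refine toHo_map_eq_zero_of_contractible X.p ι (cokernel.π ι ≫ X.i) (sqc.lift ≫ sqh.lift)
      ?_ ?_ _ ?_
    · rw [Category.assoc, X.fac, he, Category.assoc, sqh.fac_right]
    · rw [← Category.assoc, cokernel.condition, zero_comp]
    · rw [Category.assoc, kernel.lift_ι, ← Category.assoc, ← Category.assoc, sqc.fac_left]
  have : IsIso ((toHo C).map ε) := (weakEquivalences C).Q_inverts _ (mem_weakEquivalences ε)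
  rw [Functor.map_comp] at key
  exact (cancel_epi ((toHo C).map ε)).1 (key.trans (comp_toHo_map_zero _).symm)

/-- The point-set model for `ΣΩB`. -/
lemma suspension_loops_obj (B : C) :
    (suspension C).obj ((loops C).obj ((toHo C).obj B)) =
      (toHo C).obj ((pointSetSuspension C).obj ((cofibrantReplacement C).obj
        ((pointSetLoops C).obj ((fibrantReplacement C).obj B)))) :=
  -- Both derived functors are strict lifts along the localization functor, so their values on
  -- objects compute definitionally.
  rfl

end SuspensionOfLoops

end ObstructionTheory

/-! ### The retraction from the vanishing obstruction. -/

theorem corollary7p4 {C : Type u} [Category.{v} C] [ModelCategory C]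
    [HasZeroMorphisms C] [HasZeroObject C]
    [MorphismProperty.HasFunctorialFactorization (cofibrations C) (trivialFibrations C)]
    [MorphismProperty.HasFunctorialFactorization (trivialCofibrations C) (fibrations C)]
    (B : C) [IsCofibrant B]
    (h : ObstructionTheory.HasFibrantObstructionTheory (0 : (0 : C) ⟶ B)) :
    ∃ R S : C,
      ObstructionTheory.WeaklyEquivalent B R ∧
      Nonempty (Retract R S) ∧
      Nonempty ((ObstructionTheory.toHo C).obj S ≅
        (ObstructionTheory.suspension C).obj ((ObstructionTheory.loops C).obj
          ((ObstructionTheory.toHo C).obj B))) := by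
  obtain ⟨O⟩ := h
  let Y := (ObstructionTheory.fibrantReplacement C).obj B
  have : IsFibrant Y := inferInstanceAs (IsFibrant ((ObstructionTheory.fibrantReplacement C).obj B))
  let j : B ⟶ Y := (ObstructionTheory.toFibrantReplacement C).app B
  obtain ⟨_, _⟩ : Cofibration j ∧ WeakEquivalence j :=
    (mem_trivialCofibrations_iff _).1 ((ObstructionTheory.trivCofFib C).hi
      ((ObstructionTheory.toZero C).obj B))
  obtain ⟨X, p, _, t, _, a, w, ha⟩ := ObstructionTheory.exists_fibration_suspension_loops Y
  let π : (ObstructionTheory.path C).obj Y ⟶ Y := (ObstructionTheory.pathProjection C).app Y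
  have : Fibration π := inferInstanceAs (Fibration ((ObstructionTheory.pathProjection C).app Y))
  -- This square need not have a lift; only its composite with `φ` is shown to have trivial
  -- obstruction.
  let sq : Arrow.mk (0 : (0 : C) ⟶ B) ⟶ Arrow.mk π := Arrow.homMk 0 j (by simp)
  let φ : Arrow.mk π ⟶ Arrow.mk p := Arrow.homMk a (𝟙 Y) w.symm
  have hO : O.obstruction p (sq ≫ φ) = (ObstructionTheory.toHo C).map 0 := by
    rw [O.obstruction_comp π p sq φ]
    exact (congrArg (O.obstruction π sq ≫ ·) ha).trans (ObstructionTheory.comp_toHo_map_zero _)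
  obtain ⟨l, _, hl⟩ := (O.exists_lift_iff p (sq ≫ φ)).2 hO
  have hl' : l ≫ p = j := hl.trans (Category.comp_id j)
  -- `l` is defined only on `B`; lifting the trivial cofibration `j` against `p` extends it to a
  -- section over `Y`.
  have sql : CommSq l j p (𝟙 Y) := ⟨by rw [hl', Category.comp_id]⟩
  have : IsIso ((ObstructionTheory.toHo C).map t) :=
    (weakEquivalences C).Q_inverts _ (mem_weakEquivalences t)
  exact ⟨Y, X, .rel _ _ ⟨j, ‹_›⟩, ⟨⟨sql.lift, p, sql.fac_right⟩⟩,
    ⟨(asIso ((ObstructionTheory.toHo C).map t)).symm ≪≫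
      eqToIso (ObstructionTheory.suspension_loops_obj B).symm⟩⟩
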